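/- Let $(\Omega,\mathcal A,\mu)$ be a probability space, let $n\ge 0$ be an integer, let $\mathbb P=\mu^n$ be the product measure on $\Omega^n$, and let $\mathcal F$ be a nonempty countable class of measurable functions $f:\Omega\to[0,1]$. Write $\mu f=\int f\,d\mu$ and, for $x=(x_1,\dots,x_n)\in\Omega^n$, $$Z(x)=\sup_{f\in\mathcal F}\sum_{i\le n}\bigl(\mu f-f(x_i)\bigr),\qquad \sigma^2=n\sup_{f\in\mathcal F}\mu f^2,\quad \sigma\ge 0 .$$ Let $L=1.12$ and let $M$ be a median of $Z$, i.e. $\mathbb P(Z\le M)\ge\frac12$ and $\mathbb P(Z\ge M)\ge\frac12$. Then for every $u\ge 0$, $$\mathbb P\bigl(Z\ge M+2\max(Lu,\sigma\sqrt{Lu})\bigr)\le 2e^{-u}\quad\text{and}\quad \mathbb P\bigl(Z\le M-2\max(Lu,\sigma\sqrt{Lu})\bigr)\le 2e^{-u}.$$ -/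

import Mathlib

open MeasureTheory

/-- The supremum of the (unnormalized) empirical process,
`Z(x) = sup_{f ∈ F} ∑_{i ≤ n} (μ f - f (x_i))`, as a function on `Ω ^ n`.
For a nonempty class of functions with values in `[0, 1]` the supremum is over a nonempty
set of reals bounded by `n`. -/
noncomputable def empiricalSup {Ω : Type*} [MeasurableSpace Ω] (μ : Measure Ω)
    (F : Set (Ω → ℝ)) (n : ℕ) (x : Fin n → Ω) : ℝ :=
  ⨆ f : F, ∑ i : Fin n, ((∫ ω, f.1 ω ∂μ) - f.1 (x i))

/-- The uniform second moment `σ² = n * sup_{f ∈ F} μ (f²)`. -/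
noncomputable def uniformSecondMoment {Ω : Type*} [MeasurableSpace Ω] (μ : Measure Ω)
    (F : Set (Ω → ℝ)) (n : ℕ) : ℝ :=
  (n : ℝ) * ⨆ f : F, ∫ ω, (f.1 ω) ^ 2 ∂μ

/-- `M` is a median of the real random variable `Z` under the probability measure `P`:
`P (Z ≤ M) ≥ 1/2` and `P (Z ≥ M) ≥ 1/2`. -/
def IsMedian {X : Type*} [MeasurableSpace X] (P : Measure X) (Z : X → ℝ) (M : ℝ) : Prop :=
  1 / 2 ≤ P.real {x | Z x ≤ M} ∧ 1 / 2 ≤ P.real {x | M ≤ Z x}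

/-!
The proof follows Talagrand's induction method for product measures, with a quadratic-linear
transport cost, and reduces to a finite alphabet `T` with weights `p`.

For `A ⊆ T ^ n` of positive weight `P A`, there is a cost `c : T ^ n → ℝ` with
`∑ x, P x * exp (c x / L) ≤ 1 / P A` and such that, for all `f i : T → [0, 1]` and all `δ ≥ 1`,
some `y ∈ A` satisfies `∑ i, (f i (y i) - f i (x i)) ≤ (∑ i, p (f i ^ 2)) / δ + δ * c x`
(`exists_convex_cost`). If every `x ∈ B` has a single `f` for which the left side is at least
`2 * max (L * u) (σ * √(L * u))` for all `y ∈ A`, the choice `δ = max 1 (σ / √(L * u))` forces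
`c x ≥ L * u` on `B`, whence `P A * P B ≤ exp (-u)` (`prodWeight_mul_prodWeight_le`). The cost is
described only through its effect on test functions, so that no measures on `A`, marginals or
densities have to be handled; the averaging which produces `y` is done one coordinate at a time.

The induction step rests on a one-coordinate statement (`exists_kernel`): given the weights `g t` of
the sections of `A`, mass at `ω` is moved to points `t` with larger `g t`. The optimal
quadratic-linear plan has density `2 * L * (X t - X ω)⁺` with respect to `p`, where `X` is `log g`
truncated from below and shifted so that `0 ≤ X ≤ 1 / L` and `2 * L * E X ≤ 1`. Its value reduces
the matter to the inequality
`E (exp (-X - L * q X)) * E (exp X) ≤ 1`, with `q x = E ((X - x)⁺ ^ 2)`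
(`sum_exp_neg_mul_sum_exp_le_one`). For this, with `X'` an independent copy of `X`,
`T = E' (exp (X' - X))` and `s = L * q X`, one has `1 + E X - X ≤ T ≤ 2` and
`exp (-s) ≤ 1 - s + s ^ 2 / 2`, so that the left side is at most
`E T - E s - E ((E X - X) * s) + E (s ^ 2)`. Here `E T ≤ 1 + E s` since
`2 * cosh d ≤ 2 + L * d ^ 2` for `|d| ≤ 1 / L`, and `E (s ^ 2) ≤ E ((E X - X) * s)` follows by
symmetrizing over three independent copies (`upperMoment_sq_le`).

Finitely many functions on `Ω` are rounded down to multiples of `1 / N`, which factors them through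
a finite alphabet (`measureReal_mul_le_of_finite_separation`). The strict monotonicity of the
deviation in `u` absorbs both the rounding error and the passage to the countable supremum
(`measureReal_le_mul_measureReal_ge_le`). Taking `a = M` or `a = M - 2 * max (L * u) (σ * √(L * u))`
in the resulting bound on `P (Z ≤ a) * P (Z ≥ a + 2 * max (L * u) (σ * √(L * u)))`
gives the two tails.
-/

/-! ### Elementary bounds for the exponential -/

lemma exp_neg_le_quadratic {s : ℝ} (hs : 0 ≤ s) : Real.exp (-s) ≤ 1 - s + s ^ 2 / 2 := by
  have h1 := Real.quadratic_le_exp_of_nonneg hs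
  have h2 : Real.exp (-s) * Real.exp s = 1 := by rw [← Real.exp_add]; simp
  have h3 : 0 < Real.exp (-s) := Real.exp_pos _
  have h4 : 0 ≤ 1 - s + s ^ 2 / 2 := by nlinarith [sq_nonneg (s - 1)]
  have h5 : Real.exp (-s) * (1 + s + s ^ 2 / 2) ≤ 1 := by
    calc _ ≤ Real.exp (-s) * Real.exp s := mul_le_mul_of_nonneg_left h1 h3.le
      _ = 1 := h2
  nlinarith [sq_nonneg (s ^ 2), sq_nonneg s, mul_le_mul_of_nonneg_left h5 h4,
    mul_nonneg h3.le (sq_nonneg (s ^ 2))]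

lemma exp_add_exp_neg_le {L d : ℝ} (hL : 1.12 ≤ L) (hd : |d| ≤ 1 / L) :
    Real.exp d + Real.exp (-d) ≤ 2 + L * d ^ 2 := by
  have hL' : 1 / L ≤ 0.893 := by
    rw [div_le_iff₀ (by linarith)]; linarith
  have hd1 : |d| ≤ 0.893 := hd.trans hL'
  have h1 := (abs_le.1 (Real.exp_bound (x := d) (by linarith) (n := 6) (by norm_num))).2
  have h2 := (abs_le.1 (Real.exp_bound (x := -d) (by rw [abs_neg]; linarith) (n := 6)
    (by norm_num))).2
  have h6 : |d| ^ 6 = (d ^ 2) ^ 3 := by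
    rw [← sq_abs d]; ring
  have hsq : d ^ 2 ≤ 0.8 := by
    rw [← sq_abs d]; nlinarith [abs_nonneg d]
  rw [abs_neg] at h2
  rw [h6] at h1 h2
  norm_num [Finset.sum_range_succ, Nat.factorial] at h1 h2
  have h0 := sq_nonneg d
  have hc : (d ^ 2) ^ 2 ≤ 0.8 * d ^ 2 := by nlinarith
  have hc3 : (d ^ 2) ^ 3 ≤ 0.64 * d ^ 2 := by nlinarith
  nlinarith

lemma exp_inv_le_three {L : ℝ} (hL : 1.12 ≤ L) : Real.exp (1 / L) ≤ 3 := by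
  have : 1 / L ≤ 1 := by
    rw [div_le_iff₀ (by linarith)]; linarith
  have h1 := Real.exp_le_exp.2 this
  have h2 := Real.exp_one_lt_d9
  linarith

/-! ### The exponential inequality for bounded variables -/

/-- The integrand which, averaged over independent copies `a, b, c` of `X`, gives
`E ((E X - X) * q X) - L * E (q X ^ 2)` with `q x = E ((X - x)⁺ ^ 2)`. -/
def tripleTerm (L a b c : ℝ) : ℝ :=
  (b - a) * max (c - a) 0 ^ 2 - L * max (b - a) 0 ^ 2 * max (c - a) 0 ^ 2

/-- With `u = b - a` and `v = c - b`, the terms linear in `L` combine to `-2 * L * u² * (u + v)²` and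
the others to `u² * (2 * u + 3 * v)`, so that `L * (u + v) ≤ 1` suffices. -/
lemma triple_sorted {L a b c : ℝ} (hL : 0 < L) (hab : a ≤ b) (hbc : b ≤ c)
    (hac : c - a ≤ 1 / L) :
    0 ≤ tripleTerm L a b c + tripleTerm L a c b + tripleTerm L b a c + tripleTerm L b c a
      + tripleTerm L c a b + tripleTerm L c b a := by
  have hac' : L * (c - a) ≤ 1 := by rwa [le_div_iff₀ hL, mul_comm] at hac
  obtain ⟨u, rfl⟩ : ∃ u, b = a + u := ⟨b - a, by ring⟩
  obtain ⟨v, rfl⟩ : ∃ v, c = a + u + v := ⟨c - (a + u), by ring⟩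
  have hu : 0 ≤ u := by linarith
  have hv : 0 ≤ v := by linarith
  have e1 : a + u - a = u := by ring
  have e2 : a + u + v - a = u + v := by ring
  have e3 : a - (a + u) = -u := by ring
  have e4 : a + u + v - (a + u) = v := by ring
  have e5 : a - (a + u + v) = -(u + v) := by ring
  have e6 : a + u - (a + u + v) = -v := by ring
  have huv : 0 ≤ u + v := by linarith
  simp only [tripleTerm, e1, e2, e3, e4, e5, e6, max_eq_left hu, max_eq_left hv, max_eq_left huv,
    max_eq_right (neg_nonpos.2 hu), max_eq_right (neg_nonpos.2 hv),
    max_eq_right (neg_nonpos.2 huv)]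
  rw [e2] at hac'
  have : 0 ≤ u ^ 2 * (u + v) * (1 - L * (u + v)) :=
    mul_nonneg (mul_nonneg (sq_nonneg _) huv) (by linarith)
  nlinarith [mul_nonneg (sq_nonneg u) hv]

lemma triple_nonneg {L a b c : ℝ} (hL : 0 < L) (hab : |a - b| ≤ 1 / L) (hbc : |b - c| ≤ 1 / L)
    (hac : |a - c| ≤ 1 / L) :
    0 ≤ tripleTerm L a b c + tripleTerm L a c b + tripleTerm L b a c + tripleTerm L b c a
      + tripleTerm L c a b + tripleTerm L c b a := by
  rw [abs_le] at hab hbc hac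
  rcases le_total a b with h1 | h1 <;> rcases le_total b c with h2 | h2 <;>
    rcases le_total a c with h3 | h3
  · linarith [triple_sorted hL h1 h2 (by linarith)]
  · linarith [triple_sorted hL h1 h2 (by linarith)]
  · linarith [triple_sorted hL h3 h2 (by linarith)]
  · linarith [triple_sorted hL h3 h1 (by linarith)]
  · linarith [triple_sorted hL h1 h3 (by linarith)]
  · linarith [triple_sorted hL h2 h3 (by linarith)]
  · linarith [triple_sorted hL h2 h1 (by linarith)]
  · linarith [triple_sorted hL h2 h1 (by linarith)]

section
variable {T : Type*} [Fintype T]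

/-- The upper second moment `E ((X - x)⁺ ^ 2)` of `X` about `x`, for the weights `p`. -/
noncomputable def upperMoment (p X : T → ℝ) (x : ℝ) : ℝ := ∑ j, p j * max (X j - x) 0 ^ 2

lemma upperMoment_nonneg {p : T → ℝ} (hp : ∀ i, 0 ≤ p i) (X : T → ℝ) (x : ℝ) :
    0 ≤ upperMoment p X x :=
  Finset.sum_nonneg fun j _ => mul_nonneg (hp j) (sq_nonneg _)

/-- In expectation notation, `L * E (q X ^ 2) ≤ E ((E X - X) * q X)` for `q x = E ((X - x)⁺ ^ 2)`: the
difference is a triple sum whose symmetrization has nonnegative terms. -/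
lemma upperMoment_sq_le {p X : T → ℝ} {L : ℝ} (hL : 0 < L) (hp : ∀ i, 0 ≤ p i)
    (hp1 : ∑ i, p i = 1) (hX : ∀ i j, |X i - X j| ≤ 1 / L) :
    L * ∑ i, p i * upperMoment p X (X i) ^ 2 ≤
      ∑ i, p i * ((∑ j, p j * X j - X i) * upperMoment p X (X i)) := by
  set t : T → T → T → ℝ := fun i j k => p i * p j * p k * tripleTerm L (X i) (X j) (X k) with ht
  have key : ∑ i, p i * ((∑ j, p j * X j - X i) * upperMoment p X (X i)) -
      L * ∑ i, p i * upperMoment p X (X i) ^ 2 = ∑ i, ∑ j, ∑ k, t i j k := by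
    rw [Finset.mul_sum, ← Finset.sum_sub_distrib]
    refine Finset.sum_congr rfl fun i _ => ?_
    have hm : ∑ j, p j * X j - X i = ∑ j, p j * (X j - X i) := by
      simp only [mul_sub, Finset.sum_sub_distrib, ← Finset.sum_mul, hp1, one_mul]
    rw [hm, pow_two]
    simp only [upperMoment]
    rw [Finset.sum_mul_sum, Finset.sum_mul_sum, Finset.mul_sum, Finset.mul_sum, Finset.mul_sum,
      ← Finset.sum_sub_distrib]
    refine Finset.sum_congr rfl fun j _ => ?_
    rw [Finset.mul_sum, Finset.mul_sum, Finset.mul_sum, ← Finset.sum_sub_distrib]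
    refine Finset.sum_congr rfl fun k _ => ?_
    simp only [ht, tripleTerm]
    ring
  have s1 : ∑ i, ∑ j, ∑ k, t i j k = ∑ i, ∑ j, ∑ k, t i k j :=
    Finset.sum_congr rfl fun i _ => Finset.sum_comm
  have s2 (r : T → T → T → ℝ) : ∑ i, ∑ j, ∑ k, r i j k = ∑ i, ∑ j, ∑ k, r j i k :=
    Finset.sum_comm
  have s3 (r : T → T → T → ℝ) : ∑ i, ∑ j, ∑ k, r i j k = ∑ i, ∑ j, ∑ k, r i k j :=
    Finset.sum_congr rfl fun i _ => Finset.sum_comm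
  have hsum : 6 * ∑ i, ∑ j, ∑ k, t i j k =
      ∑ i, ∑ j, ∑ k, (t i j k + t i k j + t j i k + t j k i + t k i j + t k j i) := by
    simp only [Finset.sum_add_distrib]
    have a1 := s3 t
    have a2 := s2 t
    have a3 := s3 (fun i j k => t j i k)
    have a4 := s2 (fun i j k => t i k j)
    have a5 := s3 (fun i j k => t j k i)
    beta_reduce at a1 a2 a3 a4 a5
    linarith
  have hnn : 0 ≤ ∑ i, ∑ j, ∑ k, (t i j k + t i k j + t j i k + t j k i + t k i j + t k j i) := by
    refine Finset.sum_nonneg fun i _ => Finset.sum_nonneg fun j _ => Finset.sum_nonneg fun k _ => ?_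
    have h := mul_nonneg (mul_nonneg (mul_nonneg (hp i) (hp j)) (hp k))
      (triple_nonneg hL (hX i j) (hX j k) (hX i k))
    simp only [ht]
    linarith
  linarith

/-- Symmetrizing in the two copies of `X` turns `exp` into `cosh`, and
`(X' - X) ^ 2 = (X' - X)⁺ ^ 2 + (X - X')⁺ ^ 2`. -/
lemma sum_sum_exp_sub_le {p X : T → ℝ} {L : ℝ} (hL : 1.12 ≤ L) (hp : ∀ i, 0 ≤ p i)
    (hp1 : ∑ i, p i = 1) (hX : ∀ i j, |X i - X j| ≤ 1 / L) :
    ∑ i, p i * ∑ j, p j * Real.exp (X j - X i) ≤ 1 + L * ∑ i, p i * upperMoment p X (X i) := by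
  have e1 : ∑ i, p i * ∑ j, p j * Real.exp (X j - X i) =
      ∑ i, ∑ j, p i * p j * Real.exp (X j - X i) := by
    simp only [Finset.mul_sum, mul_assoc]
  have e2 : ∑ i, ∑ j, p i * p j * Real.exp (X j - X i) =
      ∑ i, ∑ j, p i * p j * Real.exp (-(X j - X i)) := by
    rw [Finset.sum_comm]
    refine Finset.sum_congr rfl fun i _ => Finset.sum_congr rfl fun j _ => ?_
    rw [neg_sub, mul_comm (p i)]
  have f1 : ∑ i, p i * upperMoment p X (X i) =
      ∑ i, ∑ j, p i * p j * max (X j - X i) 0 ^ 2 := by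
    simp only [upperMoment, Finset.mul_sum, mul_assoc]
  have f2 : ∑ i, ∑ j, p i * p j * max (X j - X i) 0 ^ 2 =
      ∑ i, ∑ j, p i * p j * max (-(X j - X i)) 0 ^ 2 := by
    rw [Finset.sum_comm]
    refine Finset.sum_congr rfl fun i _ => Finset.sum_congr rfl fun j _ => ?_
    rw [neg_sub, mul_comm (p i)]
  have g : ∑ i, ∑ j, p i * p j = 1 := by
    rw [← Finset.sum_mul_sum, hp1, one_mul]
  have hle : ∑ i, ∑ j, p i * p j * (Real.exp (X j - X i) + Real.exp (-(X j - X i))) ≤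
      ∑ i, ∑ j, p i * p j *
        (2 + L * (max (X j - X i) 0 ^ 2 + max (-(X j - X i)) 0 ^ 2)) := by
    refine Finset.sum_le_sum fun i _ => Finset.sum_le_sum fun j _ =>
      mul_le_mul_of_nonneg_left ?_ (mul_nonneg (hp i) (hp j))
    refine (exp_add_exp_neg_le hL (hX j i)).trans_eq ?_
    rcases le_total 0 (X j - X i) with h | h
    · rw [max_eq_left h, max_eq_right (neg_nonpos.2 h)]; ring
    · rw [max_eq_right h, max_eq_left (neg_nonneg.2 h)]; ring
  have hr : ∑ i, ∑ j, p i * p j *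
        (2 + L * (max (X j - X i) 0 ^ 2 + max (-(X j - X i)) 0 ^ 2)) =
      2 * ∑ i, ∑ j, p i * p j + L * (∑ i, ∑ j, p i * p j * max (X j - X i) 0 ^ 2 +
        ∑ i, ∑ j, p i * p j * max (-(X j - X i)) 0 ^ 2) := by
    simp only [Finset.mul_sum, ← Finset.sum_add_distrib]
    refine Finset.sum_congr rfl fun i _ => Finset.sum_congr rfl fun j _ => ?_
    ring
  rw [hr, g, ← f2] at hle
  simp only [mul_add, Finset.sum_add_distrib] at hle
  rw [← e2] at hle
  rw [e1, f1]
  linarith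

/-- The inequality to which the one-coordinate step reduces; it is invariant under translations of
`X` apart from the normalization `0 ≤ X`. -/
theorem sum_exp_neg_mul_sum_exp_le_one {p X : T → ℝ} {L : ℝ} (hL : 1.12 ≤ L) (hp : ∀ i, 0 ≤ p i)
    (hp1 : ∑ i, p i = 1) (hX0 : ∀ i, 0 ≤ X i) (hX1 : ∀ i, X i ≤ 1 / L)
    (hm : 2 * L * ∑ i, p i * X i ≤ 1) :
    (∑ i, p i * Real.exp (-X i - L * upperMoment p X (X i))) * ∑ j, p j * Real.exp (X j) ≤ 1 := by
  have hL0 : 0 < L := by linarith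
  have hX : ∀ i j, |X i - X j| ≤ 1 / L := fun i j => by
    rw [abs_le]; constructor <;> linarith [hX0 i, hX1 i, hX0 j, hX1 j]
  set q : T → ℝ := fun i => upperMoment p X (X i) with hq
  set m := ∑ i, p i * X i with hmdef
  have hq0 : ∀ i, 0 ≤ q i := fun i => upperMoment_nonneg hp X _
  -- `E exp X ≤ 2`, since `exp` lies below its chord on `[0, 1 / L]` and `E X ≤ 1 / (2 L)`
  have hS : ∑ j, p j * Real.exp (X j) ≤ 2 := by
    have hchord : ∀ j, Real.exp (X j) ≤ 1 + 2 * L * X j := by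
      intro j
      have hc := convexOn_exp.2 (Set.mem_univ (0 : ℝ)) (Set.mem_univ (1 / L))
        (show (0 : ℝ) ≤ 1 - L * X j by have := hX1 j; rw [le_div_iff₀ hL0] at this; linarith)
        (mul_nonneg hL0.le (hX0 j)) (by ring)
      have he : (1 - L * X j) • (0 : ℝ) + (L * X j) • (1 / L) = X j := by
        simp only [smul_eq_mul]; field_simp; ring
      rw [he, Real.exp_zero, smul_eq_mul, smul_eq_mul] at hc
      nlinarith [exp_inv_le_three hL, mul_nonneg hL0.le (hX0 j)]
    calc ∑ j, p j * Real.exp (X j) ≤ ∑ j, p j * (1 + 2 * L * X j) :=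
          Finset.sum_le_sum fun j _ => mul_le_mul_of_nonneg_left (hchord j) (hp j)
      _ = 1 + 2 * L * m := by
          simp only [mul_add, mul_one, Finset.sum_add_distrib, hp1, hmdef, Finset.mul_sum]
          congr 1
          exact Finset.sum_congr rfl fun j _ => by ring
      _ ≤ 2 := by linarith
  have hpt : ∀ i, Real.exp (-X i - L * q i) * ∑ j, p j * Real.exp (X j) ≤
      ∑ j, p j * Real.exp (X j - X i) - L * q i - L * ((m - X i) * q i) + L ^ 2 * q i ^ 2 := by
    intro i
    have hTi : Real.exp (-X i) * ∑ j, p j * Real.exp (X j) =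
        ∑ j, p j * Real.exp (X j - X i) := by
      rw [Finset.mul_sum]
      refine Finset.sum_congr rfl fun j _ => ?_
      rw [sub_eq_add_neg, Real.exp_add]; ring
    have hlow : 1 + (m - X i) ≤ ∑ j, p j * Real.exp (X j - X i) := by
      calc 1 + (m - X i) = ∑ j, p j * ((X j - X i) + 1) := by
            simp only [mul_add, mul_sub, mul_one, Finset.sum_add_distrib, Finset.sum_sub_distrib,
              ← Finset.sum_mul, hp1, hmdef]; ring
        _ ≤ _ := Finset.sum_le_sum fun j _ =>
            mul_le_mul_of_nonneg_left (Real.add_one_le_exp _) (hp j)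
    have hup : ∑ j, p j * Real.exp (X j - X i) ≤ 2 := by
      refine le_trans (Finset.sum_le_sum fun j _ => mul_le_mul_of_nonneg_left
        (Real.exp_le_exp.2 ?_) (hp j)) hS
      linarith [hX0 i]
    have hT0 : 0 ≤ ∑ j, p j * Real.exp (X j - X i) :=
      Finset.sum_nonneg fun j _ => mul_nonneg (hp j) (Real.exp_pos _).le
    have hs := exp_neg_le_quadratic (mul_nonneg hL0.le (hq0 i))
    rw [sub_eq_add_neg, Real.exp_add, mul_right_comm, hTi]
    nlinarith [mul_le_mul_of_nonneg_left hs hT0,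
      mul_le_mul_of_nonneg_right hlow (mul_nonneg hL0.le (hq0 i)),
      mul_le_mul_of_nonneg_right hup (sq_nonneg (L * q i))]
  have h1 := sum_sum_exp_sub_le hL hp hp1 hX
  have h2 := upperMoment_sq_le hL0 hp hp1 hX
  calc (∑ i, p i * Real.exp (-X i - L * q i)) * ∑ j, p j * Real.exp (X j)
      = ∑ i, p i * (Real.exp (-X i - L * q i) * ∑ j, p j * Real.exp (X j)) := by
        rw [Finset.sum_mul]; exact Finset.sum_congr rfl fun i _ => by ring
    _ ≤ ∑ i, p i * (∑ j, p j * Real.exp (X j - X i) - L * q i - L * ((m - X i) * q i)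
          + L ^ 2 * q i ^ 2) :=
        Finset.sum_le_sum fun i _ => mul_le_mul_of_nonneg_left (hpt i) (hp i)
    _ = ∑ i, p i * ∑ j, p j * Real.exp (X j - X i) - L * ∑ i, p i * q i -
          L * (∑ i, p i * ((m - X i) * q i) - L * ∑ i, p i * q i ^ 2) := by
        simp only [mul_sub, Finset.mul_sum, ← Finset.sum_sub_distrib]
        refine Finset.sum_congr rfl fun i _ => ?_
        rw [mul_add, mul_sub, mul_sub, Finset.mul_sum]; ring
    _ ≤ 1 := by
        have := mul_nonneg hL0.le (sub_nonneg.2 h2)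
        linarith
end

/-! ### Optimal one-coordinate moves -/

section
variable {T : Type*}

/-- The logarithm of `g` truncated from below at level `τ` and shifted to start at `0`:
`max (log g) τ - τ`. The maximum is taken inside the logarithm so that zeros of `g` are harmless. -/
noncomputable def truncatedLog (g : T → ℝ) (τ : ℝ) (t : T) : ℝ :=
  Real.log (max (g t) (Real.exp τ)) - τ

lemma truncatedLog_nonneg (g : T → ℝ) (τ : ℝ) (t : T) : 0 ≤ truncatedLog g τ t := by
  rw [truncatedLog, sub_nonneg, Real.le_log_iff_exp_le (lt_max_of_lt_right (Real.exp_pos _))]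
  exact le_max_right _ _

lemma truncatedLog_of_le {g : T → ℝ} {τ : ℝ} {t : T} (h : Real.exp τ ≤ g t) :
    truncatedLog g τ t = Real.log (g t) - τ := by
  rw [truncatedLog, max_eq_left h]

lemma truncatedLog_of_ge {g : T → ℝ} {τ : ℝ} {t : T} (h : g t ≤ Real.exp τ) :
    truncatedLog g τ t = 0 := by
  rw [truncatedLog, max_eq_right h, Real.log_exp, sub_self]

lemma le_exp_truncatedLog (g : T → ℝ) (τ : ℝ) (t : T) :
    g t ≤ Real.exp τ * Real.exp (truncatedLog g τ t) := by
  rw [← Real.exp_add, truncatedLog, add_sub_cancel,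
    Real.exp_log (lt_max_of_lt_right (Real.exp_pos _))]
  exact le_max_left _ _

variable [Fintype T]

/-- The level is the smallest one keeping both the range below `1 / L` and the total mass of the
optimal plan below `1`; at that level one of the two constraints is saturated. -/
lemma exists_truncation_level {p g : T → ℝ} {L : ℝ} (hL : 0 < L) {t₀ : T}
    (ht₀ : ∀ t, g t ≤ g t₀) (hg : 0 < g t₀) :
    ∃ τ, Real.exp τ ≤ g t₀ ∧ (∀ t, truncatedLog g τ t ≤ 1 / L) ∧
      2 * L * ∑ t, p t * truncatedLog g τ t ≤ 1 ∧
      (truncatedLog g τ t₀ = 1 / L ∨ 2 * L * ∑ t, p t * truncatedLog g τ t = 1) := by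
  set G := Real.log (g t₀) with hG
  have hexpG : Real.exp G = g t₀ := Real.exp_log hg
  set φ : ℝ → ℝ := fun τ => 2 * L * ∑ t, p t * truncatedLog g τ t with hφ
  have hcont : Continuous φ := by
    refine continuous_const.mul (continuous_finsetSum _ fun t _ => continuous_const.mul ?_)
    refine Continuous.sub (Continuous.log ?_ fun τ => ?_) continuous_id
    · exact continuous_const.max Real.continuous_exp
    · exact (lt_max_of_lt_right (Real.exp_pos _)).ne'
  have hφG : φ G = 0 := by
    simp [hφ, truncatedLog_of_ge (le_of_le_of_eq (ht₀ _) hexpG.symm)]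
  have hL' : 0 < 1 / L := by positivity
  have hbound : ∀ τ, G - 1 / L ≤ τ → τ ≤ G → ∀ t, truncatedLog g τ t ≤ 1 / L := by
    intro τ h1 h2 t
    rw [truncatedLog, sub_le_iff_le_add,
      Real.log_le_iff_le_exp (lt_max_of_lt_right (Real.exp_pos _))]
    refine max_le ((ht₀ t).trans ?_) (Real.exp_le_exp.2 (by linarith))
    rw [← hexpG]
    exact Real.exp_le_exp.2 (by linarith)
  by_cases hc : φ (G - 1 / L) ≤ 1
  · have hle : Real.exp (G - 1 / L) ≤ g t₀ := by
      rw [← hexpG]; exact Real.exp_le_exp.2 (by linarith)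
    refine ⟨G - 1 / L, hle, hbound _ le_rfl (by linarith), hc, Or.inl ?_⟩
    rw [truncatedLog_of_le hle]; linarith
  · obtain ⟨τ, ⟨h1, h2⟩, h3⟩ := intermediate_value_Icc' (f := φ) (a := G - 1 / L) (b := G)
      (by linarith) hcont.continuousOn ⟨(hφG.le.trans zero_le_one : φ G ≤ 1), (not_le.1 hc).le⟩
    refine ⟨τ, ?_, hbound τ h1 h2, h3.le, Or.inr h3⟩
    rw [← hexpG]; exact Real.exp_le_exp.2 h2

/-- Moving mass from `ω` according to the weights `ξ` has cost at most `C`, in dual form: the mean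
increase of any `[0, 1]`-valued `f` is at most `p (f ^ 2) / δ + δ * C` for every `δ ≥ 1`. This holds
when `ξ` is, off `ω`, dominated by `p * h + e` with `C = p (h ^ 2) / 4 + ∑ e`. -/
def MoveCost (p : T → ℝ) (ω : T) (ξ : T → ℝ) (C : ℝ) : Prop :=
  ∀ f : T → ℝ, (∀ t, f t ∈ Set.Icc (0 : ℝ) 1) → ∀ δ : ℝ, 1 ≤ δ →
    ∑ t, ξ t * (f t - f ω) ≤ (∑ t, p t * f t ^ 2) / δ + δ * C

/-- The optimal move from `ω`: the density `h = 2 * L * (X - X ω)⁺` against `p`, and the remaining mass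
left at `ω` or, when `g ω` is below the truncation level, sent to the maximum `t₀` of `g`. -/
lemma exists_move {p g : T → ℝ} {L τ : ℝ} {t₀ : T} (hL : 0 < L) (hp : ∀ t, 0 ≤ p t)
    (hle : Real.exp τ ≤ g t₀) (hm : 2 * L * ∑ t, p t * truncatedLog g τ t ≤ 1)
    (hor : truncatedLog g τ t₀ = 1 / L ∨ 2 * L * ∑ t, p t * truncatedLog g τ t = 1) (ω : T) :
    ∃ (ξ : T → ℝ) (C : ℝ), (∀ t, 0 ≤ ξ t) ∧ ∑ t, ξ t = 1 ∧ (∀ t, g t ≤ 0 → ξ t = 0) ∧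
      MoveCost p ω ξ C ∧
      C / L - ∑ t, ξ t * Real.log (g t) =
        -τ + (-truncatedLog g τ ω -
          L * upperMoment p (truncatedLog g τ) (truncatedLog g τ ω)) := by
  classical
  set X := truncatedLog g τ with hX
  have hX0 : ∀ t, 0 ≤ X t := truncatedLog_nonneg g τ
  set h : T → ℝ := fun t => 2 * L * max (X t - X ω) 0 with hh
  have hh0 : ∀ t, 0 ≤ h t := fun t => by positivity
  set H := ∑ t, p t * h t with hH
  have hH1 : H ≤ 1 := by
    refine le_trans ?_ hm
    rw [hH, Finset.mul_sum]
    refine Finset.sum_le_sum fun t _ => ?_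
    have : max (X t - X ω) 0 ≤ X t := max_le (by linarith [hX0 ω]) (hX0 t)
    have := mul_le_mul_of_nonneg_left this (mul_nonneg (mul_nonneg two_pos.le hL.le) (hp t))
    simp only [hh]
    linarith
  -- `s` receives the mass `1 - H` left over by `h`, at the linear cost `e`; if the mass constraint
  -- is saturated and `g ω` is below the level, then `H = 1` and nothing is left over
  obtain ⟨s, e, he0, hs, hse, hval⟩ : ∃ (s : T) (e : ℝ), 0 ≤ e ∧ Real.exp τ ≤ g s ∧
      (s = ω ∨ 1 - H ≤ e) ∧ e / L - (1 - H) * Real.log (g s) = -(1 - H) * (τ + X ω) := by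
    by_cases hω : Real.exp τ ≤ g ω
    · refine ⟨ω, 0, le_rfl, hω, Or.inl rfl, ?_⟩
      have : X ω = Real.log (g ω) - τ := truncatedLog_of_le hω
      rw [this]; ring
    · have hXω : X ω = 0 := truncatedLog_of_ge (not_le.1 hω).le
      refine ⟨t₀, 1 - H, by linarith, hle, Or.inr le_rfl, ?_⟩
      have hXt : X t₀ = Real.log (g t₀) - τ := truncatedLog_of_le hle
      rcases hor with h1 | h1
      · have : Real.log (g t₀) = 1 / L + τ := by linarith
        rw [this, hXω]; ring
      · have : H = 1 := by
          rw [← h1, hH, Finset.mul_sum]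
          refine Finset.sum_congr rfl fun t _ => ?_
          simp only [hh, hXω, sub_zero, max_eq_left (hX0 t)]; ring
        rw [this]; ring
  refine ⟨fun t => p t * h t + (if t = s then 1 - H else 0), ∑ t, p t * (h t ^ 2 / 4) + e,
    fun t => ?_, ?_, fun t ht => ?_, fun f hf δ hδ => ?_, ?_⟩
  · have := mul_nonneg (hp t) (hh0 t)
    refine add_nonneg this ?_
    split_ifs <;> linarith
  · rw [Finset.sum_add_distrib, Finset.sum_ite_eq' Finset.univ s]
    simp [← hH]
  · have h1 : X t = 0 := truncatedLog_of_ge (ht.trans (Real.exp_pos _).le)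
    have h2 : t ≠ s := by
      rintro rfl
      linarith [Real.exp_pos τ]
    have h3 : h t = 0 := by
      simp only [hh, h1]
      rw [max_eq_right (by linarith [hX0 ω]), mul_zero]
    simp [h2, h3]
  · have hδ0 : 0 < δ := by linarith
    have h1 : ∑ t, p t * h t * (f t - f ω) ≤
        ∑ t, (p t * f t ^ 2 / δ + δ * (p t * (h t ^ 2 / 4))) := by
      refine Finset.sum_le_sum fun t _ => ?_
      have hsq : h t * f t ≤ f t ^ 2 / δ + δ * (h t ^ 2 / 4) := by
        have : f t ^ 2 / δ + δ * (h t ^ 2 / 4) - h t * f t = (f t - δ * h t / 2) ^ 2 / δ := by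
          field_simp; ring
        have h0 : 0 ≤ (f t - δ * h t / 2) ^ 2 / δ := by positivity
        linarith
      calc p t * h t * (f t - f ω) ≤ p t * h t * f t :=
            mul_le_mul_of_nonneg_left (by linarith [(hf ω).1]) (mul_nonneg (hp t) (hh0 t))
        _ = p t * (h t * f t) := by ring
        _ ≤ p t * (f t ^ 2 / δ + δ * (h t ^ 2 / 4)) := mul_le_mul_of_nonneg_left hsq (hp t)
        _ = _ := by ring
    have h2 : (1 - H) * (f s - f ω) ≤ δ * e := by
      rcases hse with rfl | h3
      · rw [sub_self, mul_zero]; positivity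
      · nlinarith [(hf s).1, (hf s).2, (hf ω).1]
    simp only [add_mul, Finset.sum_add_distrib, ite_mul, zero_mul, Finset.sum_ite_eq',
      Finset.mem_univ, if_true]
    rw [Finset.sum_add_distrib, ← Finset.sum_div, ← Finset.mul_sum] at h1
    linarith
  · have h1 : ∑ t, p t * (h t ^ 2 / 4) = L ^ 2 * upperMoment p X (X ω) := by
      rw [upperMoment, Finset.mul_sum]
      exact Finset.sum_congr rfl fun t _ => by simp only [hh]; ring
    have h2 : ∑ t, p t * h t * Real.log (g t) =
        (τ + X ω) * H + 2 * L * upperMoment p X (X ω) := by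
      rw [upperMoment, hH, Finset.mul_sum, Finset.mul_sum, ← Finset.sum_add_distrib]
      refine Finset.sum_congr rfl fun t _ => ?_
      rcases le_total (X t) (X ω) with h3 | h3
      · simp [hh, max_eq_right (sub_nonpos.2 h3)]
      · rcases le_or_gt (Real.exp τ) (g t) with h4 | h4
        · have h5 : X t = Real.log (g t) - τ := truncatedLog_of_le h4
          simp only [hh, max_eq_left (sub_nonneg.2 h3)]
          rw [eq_add_of_sub_eq h5.symm]; ring
        · have h5 : X t = 0 := truncatedLog_of_ge h4.le
          have h6 : X t - X ω ≤ 0 := by linarith [hX0 ω]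
          simp [hh, max_eq_right h6]
    simp only [add_mul, Finset.sum_add_distrib, ite_mul, zero_mul, Finset.sum_ite_eq',
      Finset.mem_univ, if_true]
    rw [h1, h2, add_div]
    have h3 : L ^ 2 * upperMoment p X (X ω) / L = L * upperMoment p X (X ω) := by
      field_simp
    rw [h3]
    linarith

/-- The kernel lemma: a choice of moves `ξ ω`, supported where `g` is positive, with costs `C ω`, for
which the exponential bound passes from the sections of a set to the set itself. -/
theorem exists_kernel {p g : T → ℝ} {L : ℝ} (hL : 1.12 ≤ L) (hp : ∀ t, 0 ≤ p t)
    (hp1 : ∑ t, p t = 1) (hpos : 0 < ∑ t, p t * g t) :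
    ∃ (ξ : T → T → ℝ) (C : T → ℝ), (∀ ω t, 0 ≤ ξ ω t) ∧ (∀ ω, ∑ t, ξ ω t = 1) ∧
      (∀ ω t, g t ≤ 0 → ξ ω t = 0) ∧ (∀ ω, MoveCost p ω (ξ ω) (C ω)) ∧
      ∑ ω, p ω * Real.exp (C ω / L - ∑ t, ξ ω t * Real.log (g t)) ≤ 1 / ∑ t, p t * g t := by
  have hL0 : 0 < L := by linarith
  obtain ⟨t₁, -, h1⟩ := Finset.exists_lt_of_sum_lt (s := Finset.univ) (f := fun _ : T => (0 : ℝ))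
    (g := fun t => p t * g t) (by simpa using hpos)
  have : Nonempty T := ⟨t₁⟩
  obtain ⟨t₀, ht₀⟩ := Finite.exists_max g
  have hg : 0 < g t₀ := (pos_of_mul_pos_right h1 (hp t₁)).trans_le (ht₀ t₁)
  obtain ⟨τ, hle, hX1, hm, hor⟩ := exists_truncation_level (p := p) hL0 ht₀ hg
  choose ξ C h0 hsum hsupp hmove hval using exists_move hL0 hp hle hm hor
  refine ⟨ξ, C, h0, hsum, hsupp, hmove, ?_⟩
  simp only [hval]
  have hone := sum_exp_neg_mul_sum_exp_le_one hL hp hp1 (truncatedLog_nonneg g τ) hX1 hm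
  set X := truncatedLog g τ
  have hgE : ∑ t, p t * g t ≤ Real.exp τ * ∑ t, p t * Real.exp (X t) := by
    rw [Finset.mul_sum]
    refine Finset.sum_le_sum fun t _ => ?_
    have := mul_le_mul_of_nonneg_left (le_exp_truncatedLog g τ t) (hp t)
    linarith
  rw [le_div_iff₀ hpos]
  have hE0 : 0 ≤ ∑ ω, p ω * Real.exp (-X ω - L * upperMoment p X (X ω)) :=
    Finset.sum_nonneg fun t _ => mul_nonneg (hp t) (Real.exp_pos _).le
  have hfac : ∑ ω, p ω * Real.exp (-τ + (-X ω - L * upperMoment p X (X ω))) =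
      Real.exp (-τ) * ∑ ω, p ω * Real.exp (-X ω - L * upperMoment p X (X ω)) := by
    rw [Finset.mul_sum]
    refine Finset.sum_congr rfl fun t _ => ?_
    rw [Real.exp_add]; ring
  rw [hfac]
  calc _ ≤ Real.exp (-τ) * (∑ ω, p ω * Real.exp (-X ω - L * upperMoment p X (X ω))) *
        (Real.exp τ * ∑ t, p t * Real.exp (X t)) :=
        mul_le_mul_of_nonneg_left hgE (mul_nonneg (Real.exp_pos _).le hE0)
    _ = (Real.exp (-τ) * Real.exp τ) *
        ((∑ ω, p ω * Real.exp (-X ω - L * upperMoment p X (X ω))) *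
          ∑ t, p t * Real.exp (X t)) := by ring
    _ ≤ 1 := by rw [← Real.exp_add]; simpa using hone

/-! ### Induction on the number of coordinates -/

/-- The weight of `A ⊆ T ^ n` under the `n`-fold product of the weights `p`. -/
noncomputable def prodWeight (p : T → ℝ) {n : ℕ} (A : Set (Fin n → T)) : ℝ :=
  open Classical in ∑ x, if x ∈ A then ∏ i, p (x i) else 0

/-- Talagrand's exponential bound for the distance to a set, in dual form. In the step, the cost at
`x` is the `ξ (x 0)`-average of the costs for the sections of `A`, plus the cost of the move. -/
theorem exists_convex_cost {p : T → ℝ} {L : ℝ} (hL : 1.12 ≤ L) (hp : ∀ t, 0 ≤ p t)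
    (hp1 : ∑ t, p t = 1) (n : ℕ) (A : Set (Fin n → T)) (hA : 0 < prodWeight p A) :
    ∃ c : (Fin n → T) → ℝ,
      (∀ (x : Fin n → T) (f : Fin n → T → ℝ), (∀ i t, f i t ∈ Set.Icc (0 : ℝ) 1) →
        ∀ δ : ℝ, 1 ≤ δ → ∃ y ∈ A, ∑ i, (f i (y i) - f i (x i)) ≤
          (∑ i, ∑ t, p t * f i t ^ 2) / δ + δ * c x) ∧
      ∑ x, (∏ i, p (x i)) * Real.exp (c x / L) ≤ 1 / prodWeight p A := by
  classical
  induction n with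
  | zero =>
    have hmem : (default : Fin 0 → T) ∈ A := by
      by_contra h
      have : prodWeight p A = 0 := by
        rw [prodWeight, Fintype.sum_unique, if_neg h]
      linarith
    refine ⟨fun _ => 0, fun x f _ δ _ => ⟨default, hmem, by simp⟩, ?_⟩
    rw [prodWeight, Fintype.sum_unique, Fintype.sum_unique, if_pos hmem]
    simp
  | succ n ih =>
    set S : T → Set (Fin n → T) := fun t => {z | (Fin.cons t z : Fin (n + 1) → T) ∈ A} with hS
    set g : T → ℝ := fun t => prodWeight p (S t) with hg
    have hsplit (r : (Fin (n + 1) → T) → ℝ) :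
        ∑ x, r x = ∑ t, ∑ z : Fin n → T, r (Fin.cons t z) := by
      rw [← Fintype.sum_prod_type']
      exact (Fintype.sum_equiv (Fin.consEquiv fun _ => T) _ _ fun x => rfl).symm
    have hgA : prodWeight p A = ∑ t, p t * g t := by
      rw [prodWeight, hsplit]
      refine Finset.sum_congr rfl fun t _ => ?_
      simp only [hg, prodWeight, Finset.mul_sum]
      refine Finset.sum_congr rfl fun z _ => ?_
      simp [hS, Fin.prod_univ_succ]
    have hprod (z : Fin n → T) : 0 ≤ ∏ i, p (z i) := Finset.prod_nonneg fun i _ => hp _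
    have hg0 : ∀ t, 0 ≤ g t := fun t => Finset.sum_nonneg fun z _ => by
      split_ifs
      exacts [hprod z, le_rfl]
    obtain ⟨ξ, C, hξ0, hξ1, hξg, hmove, hker⟩ := exists_kernel hL hp hp1 (hgA ▸ hA)
    -- the cost for a null section is irrelevant, as the kernel does not charge it
    have ih' : ∀ t, ∃ c : (Fin n → T) → ℝ, 0 < g t → (∀ (x : Fin n → T) (f : Fin n → T → ℝ),
        (∀ i t, f i t ∈ Set.Icc (0 : ℝ) 1) →
        ∀ δ : ℝ, 1 ≤ δ → ∃ y ∈ S t, ∑ i, (f i (y i) - f i (x i)) ≤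
          (∑ i, ∑ t, p t * f i t ^ 2) / δ + δ * c x) ∧
        ∑ x, (∏ i, p (x i)) * Real.exp (c x / L) ≤ 1 / g t := by
      intro t
      by_cases h : 0 < g t
      · obtain ⟨c, hc⟩ := ih (S t) h
        exact ⟨c, fun _ => hc⟩
      · exact ⟨0, fun h' => absurd h' h⟩
    choose c hc using ih'
    refine ⟨fun x => ∑ t, ξ (x 0) t * c t (Fin.tail x) + C (x 0), fun x f hf δ hδ => ?_, ?_⟩
    · have hδ0 : 0 < δ := by linarith
      set R := (∑ i : Fin n, ∑ t, p t * f i.succ t ^ 2) / δ with hR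
      -- averaging over `ξ` gives a first coordinate for which the bound holds
      have hex : ∃ t, 0 < g t ∧ f 0 t - f 0 (x 0) + δ * c t (Fin.tail x) ≤
          (∑ t, p t * f 0 t ^ 2) / δ + δ * (∑ t, ξ (x 0) t * c t (Fin.tail x) + C (x 0)) := by
        by_contra! hcon
        set K := (∑ t, p t * f 0 t ^ 2) / δ +
          δ * (∑ t, ξ (x 0) t * c t (Fin.tail x) + C (x 0)) with hK
        have hle : ∀ t, ξ (x 0) t * K ≤
            ξ (x 0) t * (f 0 t - f 0 (x 0) + δ * c t (Fin.tail x)) := fun t => by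
          rcases (hg0 t).eq_or_lt with h | h
          · simp [hξg (x 0) t h.ge]
          · exact mul_le_mul_of_nonneg_left (hcon t h).le (hξ0 _ _)
        obtain ⟨t, -, ht⟩ := Finset.exists_lt_of_sum_lt (s := Finset.univ)
          (f := fun _ : T => (0 : ℝ)) (g := fun t => ξ (x 0) t)
          (by simp [hξ1])
        have hgt : 0 < g t := by
          by_contra h
          exact ht.ne' (hξg (x 0) t (not_lt.1 h))
        have hlt : ∑ t, ξ (x 0) t * K <
            ∑ t, ξ (x 0) t * (f 0 t - f 0 (x 0) + δ * c t (Fin.tail x)) :=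
          Finset.sum_lt_sum (fun t _ => hle t)
            ⟨t, Finset.mem_univ _, mul_lt_mul_of_pos_left (hcon t hgt) ht⟩
        have hmv := hmove (x 0) (f 0) (hf 0) δ hδ
        have hsum : ∑ t, ξ (x 0) t * (f 0 t - f 0 (x 0) + δ * c t (Fin.tail x)) =
            ∑ t, ξ (x 0) t * (f 0 t - f 0 (x 0)) +
              δ * ∑ t, ξ (x 0) t * c t (Fin.tail x) := by
          rw [Finset.mul_sum, ← Finset.sum_add_distrib]
          exact Finset.sum_congr rfl fun t _ => by ring
        rw [← Finset.sum_mul, hξ1, one_mul, hsum, hK] at hlt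
        linarith
      obtain ⟨t, hgt, ht⟩ := hex
      obtain ⟨y, hy, hyle⟩ := (hc t hgt).1 (Fin.tail x) (fun i => f i.succ)
        (fun i => hf i.succ) δ hδ
      refine ⟨Fin.cons t y, hy, ?_⟩
      rw [Fin.sum_univ_succ, Fin.sum_univ_succ, add_div]
      simp only [Fin.cons_zero, Fin.cons_succ]
      simp only [Fin.tail] at hyle ht ⊢
      linarith
    · rw [hgA]
      refine le_trans ?_ hker
      rw [hsplit]
      refine Finset.sum_le_sum fun ω _ => ?_
      simp only [Fin.prod_univ_succ, Fin.cons_zero, Fin.cons_succ, Fin.tail_cons]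
      -- weighted Hölder inequality, in the form of Jensen's inequality for `exp`
      have hj : ∑ z : Fin n → T, (∏ i, p (z i)) *
          Real.exp (∑ t, ξ ω t * (c t z / L + Real.log (g t))) ≤ 1 := by
        calc _ ≤ ∑ z : Fin n → T, (∏ i, p (z i)) *
              ∑ t, ξ ω t * Real.exp (c t z / L + Real.log (g t)) := by
              refine Finset.sum_le_sum fun z _ => mul_le_mul_of_nonneg_left ?_ (hprod z)
              simpa only [smul_eq_mul] using convexOn_exp.map_sum_le (t := Finset.univ)
                (w := ξ ω) (p := fun t => c t z / L + Real.log (g t)) (fun t _ => hξ0 ω t)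
                (hξ1 ω) (fun t _ => Set.mem_univ _)
          _ = ∑ t, ξ ω t * ∑ z : Fin n → T, (∏ i, p (z i)) *
              Real.exp (c t z / L + Real.log (g t)) := by
              simp only [Finset.mul_sum]
              rw [Finset.sum_comm]
              exact Finset.sum_congr rfl fun t _ => Finset.sum_congr rfl fun z _ => by ring
          _ ≤ ∑ t, ξ ω t := by
              refine Finset.sum_le_sum fun t _ => ?_
              rcases (hg0 t).eq_or_lt with h | h
              · simp [hξg ω t h.ge]
              · refine mul_le_of_le_one_right (hξ0 ω t) ?_
                have h2 := (hc t h).2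
                rw [le_div_iff₀ h] at h2
                simpa only [Real.exp_add, Real.exp_log h, ← mul_assoc, ← Finset.sum_mul] using h2
          _ = 1 := hξ1 ω
      have hexp (z : Fin n → T) : Real.exp ((∑ t, ξ ω t * c t z + C ω) / L) =
          Real.exp (C ω / L - ∑ t, ξ ω t * Real.log (g t)) *
            Real.exp (∑ t, ξ ω t * (c t z / L + Real.log (g t))) := by
        rw [← Real.exp_add]
        congr 1
        simp only [mul_add, Finset.sum_add_distrib, add_div, Finset.sum_div, mul_div_assoc]
        ring
      calc _ = p ω * Real.exp (C ω / L - ∑ t, ξ ω t * Real.log (g t)) *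
            ∑ z : Fin n → T, (∏ i, p (z i)) *
              Real.exp (∑ t, ξ ω t * (c t z / L + Real.log (g t))) := by
            rw [Finset.mul_sum]
            refine Finset.sum_congr rfl fun z _ => ?_
            rw [hexp]; ring
        _ ≤ _ := mul_le_of_le_one_right (mul_nonneg (hp ω) (Real.exp_pos _).le) hj

/-- Two sets separated by test functions with second moment at most `σ ^ 2` cannot both be large. -/
theorem prodWeight_mul_prodWeight_le {p : T → ℝ} {L σ u : ℝ} (hL : 1.12 ≤ L) (hp : ∀ t, 0 ≤ p t)
    (hp1 : ∑ t, p t = 1) {n : ℕ} (A B : Set (Fin n → T)) (hσ : 0 ≤ σ) (hu : 0 < u)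
    (h : ∀ x ∈ B, ∃ f : T → ℝ, (∀ t, f t ∈ Set.Icc (0 : ℝ) 1) ∧
      n * ∑ t, p t * f t ^ 2 ≤ σ ^ 2 ∧
      ∀ y ∈ A, 2 * max (L * u) (σ * Real.sqrt (L * u)) ≤ ∑ i, (f (y i) - f (x i))) :
    prodWeight p A * prodWeight p B ≤ Real.exp (-u) := by
  classical
  have hL0 : 0 < L := by linarith
  have hLu : 0 < L * u := mul_pos hL0 hu
  have hprod (z : Fin n → T) : 0 ≤ ∏ i, p (z i) := Finset.prod_nonneg fun i _ => hp _
  have hA0 : 0 ≤ prodWeight p A := Finset.sum_nonneg fun z _ => by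
    split_ifs
    exacts [hprod z, le_rfl]
  rcases hA0.eq_or_lt with hA | hA
  · rw [← hA, zero_mul]; exact (Real.exp_pos _).le
  obtain ⟨c, hc, hint⟩ := exists_convex_cost hL hp hp1 n A hA
  have hcB : ∀ x ∈ B, L * u ≤ c x := by
    intro x hx
    obtain ⟨f, hf, hfσ, hfA⟩ := h x hx
    by_contra! hlt
    set w := Real.sqrt (L * u) with hw
    have hw0 : 0 < w := Real.sqrt_pos.2 hLu
    have hw2 : w ^ 2 = L * u := Real.sq_sqrt hLu.le
    have hbd : ∀ δ : ℝ, 1 ≤ δ → 2 * max (L * u) (σ * w) < σ ^ 2 / δ + δ * (L * u) := by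
      intro δ hδ
      have hδ0 : 0 < δ := by linarith
      obtain ⟨y, hy, hyle⟩ := hc x (fun _ => f) (fun _ => hf) δ hδ
      have h1 := hfA y hy
      simp only [Finset.sum_const, Finset.card_univ, Fintype.card_fin, nsmul_eq_mul] at hyle
      have h2 : (n * ∑ t, p t * f t ^ 2) / δ ≤ σ ^ 2 / δ := by gcongr
      have h3 := mul_lt_mul_of_pos_left hlt hδ0
      linarith
    -- the choice `δ = max 1 (σ / w)` nearly minimizes `σ ^ 2 / δ + δ * (L * u)` over `δ ≥ 1`
    rcases le_total σ w with hσw | hσw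
    · have h1 := hbd 1 le_rfl
      have h2 := le_max_left (L * u) (σ * w)
      nlinarith
    · have h1 := hbd (σ / w) ((one_le_div hw0).2 hσw)
      have h2 := le_max_right (L * u) (σ * w)
      have h3 : 0 < σ := hw0.trans_le hσw
      have h4 : σ ^ 2 / (σ / w) + σ / w * (L * u) = 2 * (σ * w) := by
        rw [← hw2]; field_simp; ring
      linarith
  have hB : prodWeight p B * Real.exp u ≤ 1 / prodWeight p A := by
    refine le_trans ?_ hint
    rw [prodWeight, Finset.sum_mul]
    refine Finset.sum_le_sum fun x _ => ?_
    split_ifs with hx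
    · refine mul_le_mul_of_nonneg_left (Real.exp_le_exp.2 ?_) (hprod x)
      rw [le_div_iff₀ hL0, mul_comm]
      exact hcB x hx
    · rw [zero_mul]
      exact mul_nonneg (hprod x) (Real.exp_pos _).le
  rw [le_div_iff₀ hA] at hB
  rw [Real.exp_neg, ← one_div, le_div_iff₀ (Real.exp_pos u)]
  linarith
end

/-! ### Discretization -/

lemma measureReal_pi_eq_prodWeight {T : Type*} [Fintype T] [MeasurableSpace T]
    [MeasurableSingletonClass T] (ν : Measure T) [IsProbabilityMeasure ν] {n : ℕ}
    (S : Set (Fin n → T)) :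
    (Measure.pi fun _ : Fin n => ν).real S = prodWeight (fun t => ν.real {t}) S := by
  classical
  have hS : S = ↑(Finset.univ.filter (· ∈ S)) := by simp
  conv_lhs => rw [hS, ← sum_measureReal_singleton]
  rw [prodWeight, Finset.sum_filter]
  refine Finset.sum_congr rfl fun x _ => ?_
  split_ifs with h
  · simp only [measureReal_def, Measure.pi_singleton, ENNReal.toReal_prod]
  · rfl

lemma sq_mem_Icc {Ω : Type*} {f : Ω → ℝ} (h01 : ∀ ω, f ω ∈ Set.Icc (0 : ℝ) 1) (ω : Ω) :
    f ω ^ 2 ∈ Set.Icc (0 : ℝ) 1 :=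
  ⟨sq_nonneg _, pow_le_one₀ (h01 ω).1 (h01 ω).2⟩

lemma uniformSecondMoment_nonneg {Ω : Type*} [MeasurableSpace Ω] (μ : Measure Ω) (n : ℕ) (F : Set (Ω → ℝ)) : 0 ≤ uniformSecondMoment μ F n :=
  mul_nonneg n.cast_nonneg (Real.iSup_nonneg fun _ => integral_nonneg fun _ => sq_nonneg _)

lemma deviation_strictMono {L σ u v : ℝ} (hL : 0 < L) (hσ : 0 ≤ σ) (hu : 0 < u) (huv : u < v) :
    max (L * u) (σ * Real.sqrt (L * u)) < max (L * v) (σ * Real.sqrt (L * v)) := by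
  have h : L * u < L * v := mul_lt_mul_of_pos_left huv hL
  refine max_lt (h.trans_le (le_max_left _ _)) ?_
  rcases hσ.eq_or_lt with rfl | hσ
  · rw [zero_mul]
    exact lt_max_of_lt_left (mul_pos hL (hu.trans huv))
  · exact lt_max_of_lt_right
      (mul_lt_mul_of_pos_left (Real.sqrt_lt_sqrt (mul_pos hL hu).le h) hσ)

section
variable {Ω : Type*} [MeasurableSpace Ω] {μ : Measure Ω} [IsProbabilityMeasure μ]

lemma integrable_of_mem_Icc {f : Ω → ℝ} (hf : Measurable f) (h01 : ∀ ω, f ω ∈ Set.Icc (0 : ℝ) 1) :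
    Integrable f μ :=
  .of_bound hf.aestronglyMeasurable 1 (ae_of_all _ fun ω => by
    rw [Real.norm_eq_abs, abs_of_nonneg (h01 ω).1]; exact (h01 ω).2)

/-- The finite separation bound on a general probability space, for sets separated by finitely many
functions; the strict inequality for `s` leaves room for rounding. -/
theorem measureReal_mul_le_of_finite_separation {L σ u s : ℝ} (hL : 1.12 ≤ L) {n k : ℕ}
    {φ : Fin k → Ω → ℝ} (hφm : ∀ j, Measurable (φ j))
    (hφ01 : ∀ j ω, φ j ω ∈ Set.Icc (0 : ℝ) 1) (hσ : 0 ≤ σ)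
    (hφσ : ∀ j, n * ∫ ω, φ j ω ^ 2 ∂μ ≤ σ ^ 2) (hu : 0 < u)
    (hs : 2 * max (L * u) (σ * Real.sqrt (L * u)) < s) (A B : Set (Fin n → Ω))
    (h : ∀ x ∈ B, ∃ j, ∀ y ∈ A, s ≤ ∑ i, (φ j (y i) - φ j (x i))) :
    (Measure.pi fun _ : Fin n => μ).real A * (Measure.pi fun _ : Fin n => μ).real B ≤
      Real.exp (-u) := by
  set r := s - 2 * max (L * u) (σ * Real.sqrt (L * u)) with hr
  have hr0 : 0 < r := sub_pos.2 hs
  obtain ⟨N, hN⟩ := exists_nat_gt (n / r)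
  have hN0 : (0 : ℝ) < N := lt_of_le_of_lt (by positivity) hN
  -- rounding down keeps the second moments below `σ ^ 2` and costs at most `1 / N` per coordinate
  set π : Ω → Fin k → Fin (N + 1) := fun ω j => Fin.ofNat (N + 1) ⌊N * φ j ω⌋₊ with hπ
  set ψ : Fin k → (Fin k → Fin (N + 1)) → ℝ := fun j t => ((t j : ℕ) : ℝ) / N with hψ
  have hπm : Measurable π := by
    refine measurable_pi_lambda _ fun j => ?_
    exact (measurable_of_countable (Fin.ofNat (N + 1))).comp
      (Nat.measurable_floor.comp ((hφm j).const_mul _))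
  have hval (j : Fin k) (ω : Ω) : ψ j (π ω) = (⌊N * φ j ω⌋₊ : ℝ) / N := by
    have : ⌊N * φ j ω⌋₊ < N + 1 := by
      refine Nat.lt_succ_of_le (Nat.floor_le_of_le ?_)
      exact mul_le_of_le_one_right hN0.le (hφ01 j ω).2
    simp only [hψ, hπ, Fin.val_ofNat, Nat.mod_eq_of_lt this]
  have hle (j : Fin k) (ω : Ω) : ψ j (π ω) ≤ φ j ω := by
    rw [hval, div_le_iff₀ hN0, mul_comm (φ j ω)]
    exact Nat.floor_le (mul_nonneg hN0.le (hφ01 j ω).1)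
  have hge (j : Fin k) (ω : Ω) : φ j ω - 1 / N ≤ ψ j (π ω) := by
    rw [hval, sub_le_iff_le_add, ← add_div, le_div_iff₀ hN0, mul_comm]
    exact (Nat.lt_floor_add_one _).le
  have hψ01 (j : Fin k) (t) : ψ j t ∈ Set.Icc (0 : ℝ) 1 := by
    refine ⟨by positivity, ?_⟩
    rw [hψ, div_le_one hN0]
    exact_mod_cast Nat.le_of_lt_succ (t j).2
  set ν := μ.map π with hν
  have : IsProbabilityMeasure ν := Measure.isProbabilityMeasure_map hπm.aemeasurable
  set D : (Fin n → Ω) → Fin n → Fin k → Fin (N + 1) := fun x i => π (x i) with hD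
  have hmap : (Measure.pi fun _ : Fin n => μ).map D = Measure.pi fun _ : Fin n => ν :=
    Measure.pi_map_pi (μ := fun _ : Fin n => μ) (f := fun _ => π) fun _ => hπm.aemeasurable
  have hDm : Measurable D :=
    measurable_pi_lambda _ fun i => hπm.comp (measurable_pi_apply i)
  have himage (S : Set (Fin n → Ω)) : (Measure.pi fun _ : Fin n => μ).real S ≤
      prodWeight (fun t => ν.real {t}) (D '' S) := by
    rw [← measureReal_pi_eq_prodWeight, ← hmap,
      map_measureReal_apply hDm (Set.toFinite _).measurableSet]
    exact measureReal_mono (Set.subset_preimage_image _ _)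
  refine (mul_le_mul (himage A) (himage B) measureReal_nonneg ?_).trans
    (prodWeight_mul_prodWeight_le hL (fun _ => measureReal_nonneg) ?_ _ _ hσ hu ?_)
  · exact measureReal_nonneg.trans (himage A)
  · have := sum_measureReal_singleton (μ := ν) Finset.univ
    rw [this]; simp
  · rintro _ ⟨x, hx, rfl⟩
    obtain ⟨j, hj⟩ := h x hx
    refine ⟨ψ j, hψ01 j, ?_, ?_⟩
    · refine le_trans (mul_le_mul_of_nonneg_left ?_ n.cast_nonneg) (hφσ j)
      have h1 : ∑ t, ν.real {t} * ψ j t ^ 2 = ∫ ω, ψ j (π ω) ^ 2 ∂μ := by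
        have h2 : ∫ t, ψ j t ^ 2 ∂ν = ∫ ω, ψ j (π ω) ^ 2 ∂μ :=
          integral_map hπm.aemeasurable (measurable_of_finite _).aestronglyMeasurable
        rw [← h2, integral_fintype .of_finite]
        rfl
      rw [h1]
      have hm : Measurable (fun ω => ψ j (π ω)) := (measurable_of_finite (ψ j)).comp hπm
      refine integral_mono
        (integrable_of_mem_Icc (hm.pow_const 2) (sq_mem_Icc fun ω => hψ01 j (π ω)))
        (integrable_of_mem_Icc ((hφm j).pow_const 2) (sq_mem_Icc (hφ01 j))) fun ω => ?_
      exact pow_le_pow_left₀ (hψ01 j _).1 (hle j ω) 2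
    · rintro _ ⟨y, hy, rfl⟩
      have h1 := hj y hy
      have h2 : ∑ i, (φ j (y i) - φ j (x i)) ≤
          ∑ i, (ψ j (D y i) - ψ j (D x i)) + n * (1 / N) := by
        calc _ ≤ ∑ i : Fin n, (ψ j (D y i) - ψ j (D x i) + 1 / N) :=
              Finset.sum_le_sum fun i _ => by linarith [hge j (y i), hle j (x i)]
          _ = _ := by simp [Finset.sum_add_distrib]
      have h3 : n * (1 / (N : ℝ)) ≤ r := by
        rw [mul_one_div, div_le_iff₀ hN0, ← div_le_iff₀' hr0]
        exact hN.le
      linarith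

/-! ### The supremum of the empirical process -/

lemma bddAbove_sum_integral_sub {n : ℕ} {F : Set (Ω → ℝ)} (hFm : ∀ f ∈ F, Measurable f)
    (hF01 : ∀ f ∈ F, ∀ ω, f ω ∈ Set.Icc (0 : ℝ) 1) (x : Fin n → Ω) :
    BddAbove (Set.range fun f : F => ∑ i : Fin n, ((∫ ω, f.1 ω ∂μ) - f.1 (x i))) := by
  refine ⟨n, ?_⟩
  rintro _ ⟨f, rfl⟩
  have h1 : ∫ ω, f.1 ω ∂μ ≤ 1 := by
    simpa using integral_mono (integrable_of_mem_Icc (μ := μ) (hFm _ f.2) (hF01 _ f.2))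
      (integrable_const (1 : ℝ)) fun ω => (hF01 _ f.2 ω).2
  calc ∑ i : Fin n, ((∫ ω, f.1 ω ∂μ) - f.1 (x i)) ≤ ∑ _i : Fin n, (1 : ℝ) :=
        Finset.sum_le_sum fun i _ => by linarith [(hF01 _ f.2 (x i)).1]
    _ = n := by simp

lemma mul_integral_sq_le_uniformSecondMoment (n : ℕ) {F : Set (Ω → ℝ)}
    (hFm : ∀ f ∈ F, Measurable f) (hF01 : ∀ f ∈ F, ∀ ω, f ω ∈ Set.Icc (0 : ℝ) 1) {f : Ω → ℝ}
    (hf : f ∈ F) : n * ∫ ω, f ω ^ 2 ∂μ ≤ uniformSecondMoment μ F n := by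
  refine mul_le_mul_of_nonneg_left (le_ciSup (f := fun f : F => ∫ ω, f.1 ω ^ 2 ∂μ) ?_ ⟨f, hf⟩)
    n.cast_nonneg
  refine ⟨1, ?_⟩
  rintro _ ⟨g, rfl⟩
  simpa using integral_mono
    (integrable_of_mem_Icc (μ := μ) ((hFm _ g.2).pow_const 2) (sq_mem_Icc (hF01 _ g.2)))
    (integrable_const (1 : ℝ)) fun ω => (sq_mem_Icc (hF01 _ g.2) ω).2

/-- The two-sided form of the concentration inequality, free of medians. -/
theorem measureReal_le_mul_measureReal_ge_le {n : ℕ} {F : Set (Ω → ℝ)} (hFne : F.Nonempty)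
    (hFc : F.Countable) (hFm : ∀ f ∈ F, Measurable f)
    (hF01 : ∀ f ∈ F, ∀ ω, f ω ∈ Set.Icc (0 : ℝ) 1) {L σ u : ℝ} (hL : 1.12 ≤ L)
    (hσ : σ = Real.sqrt (uniformSecondMoment μ F n)) (hu : 0 < u) (a : ℝ) :
    (Measure.pi fun _ : Fin n => μ).real {x | empiricalSup μ F n x ≤ a} *
      (Measure.pi fun _ : Fin n => μ).real
        {x | a + 2 * max (L * u) (σ * Real.sqrt (L * u)) ≤ empiricalSup μ F n x} ≤
      Real.exp (-u) := by
  set P := Measure.pi fun _ : Fin n => μ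
  have hσ0 : 0 ≤ σ := hσ ▸ Real.sqrt_nonneg _
  have hσ2 : σ ^ 2 = uniformSecondMoment μ F n := by
    rw [hσ, Real.sq_sqrt (uniformSecondMoment_nonneg μ n F)]
  obtain ⟨φ, rfl⟩ := hFc.exists_eq_range hFne
  set Z := empiricalSup μ (Set.range φ) n with hZ
  set S : ℕ → (Fin n → Ω) → ℝ := fun j x => ∑ i : Fin n, ((∫ ω, φ j ω ∂μ) - φ j (x i)) with hS
  have hSZ (j : ℕ) (x) : S j x ≤ Z x :=
    le_ciSup (bddAbove_sum_integral_sub hFm hF01 x) ⟨φ j, j, rfl⟩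
  have hlt {b : ℝ} {x} (hb : b < Z x) : ∃ j, b < S j x := by
    have : Nonempty (Set.range φ) := hFne.to_subtype
    obtain ⟨⟨_, j, rfl⟩, hj⟩ := exists_lt_of_lt_ciSup hb
    exact ⟨j, hj⟩
  set τ : ℝ → ℝ := fun u => 2 * max (L * u) (σ * Real.sqrt (L * u)) with hτ
  have hmain : ∀ v, 0 < v → v < u →
      P.real {x | Z x ≤ a} * P.real {x | a + τ u ≤ Z x} ≤ Real.exp (-v) := by
    intro v hv hvu
    have hτlt : τ v < τ u :=
      mul_lt_mul_of_pos_left (deviation_strictMono (by linarith) hσ0 hv hvu) two_pos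
    obtain ⟨s, hs1, hs2⟩ := exists_between hτlt
    -- the events on which one of the first `k` functions already witnesses a large supremum
    set B : ℕ → Set (Fin n → Ω) := fun k => {x | ∃ j < k, a + s < S j x} with hB
    have hBmono : Monotone B := fun k l hkl x ⟨j, hj, hx⟩ => ⟨j, hj.trans_le hkl, hx⟩
    have hBk (k : ℕ) : P.real {x | Z x ≤ a} * P.real (B k) ≤ Real.exp (-v) := by
      refine measureReal_mul_le_of_finite_separation (k := k) (φ := fun j => φ j) hL
        (fun j => hFm _ ⟨j, rfl⟩) (fun j => hF01 _ ⟨j, rfl⟩) hσ0 (fun j => ?_) hv hs1 _ _ ?_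
      · rw [hσ2]
        exact mul_integral_sq_le_uniformSecondMoment n hFm hF01 ⟨j, rfl⟩
      · rintro x ⟨j, hj, hx⟩
        refine ⟨⟨j, hj⟩, fun y hy => ?_⟩
        have h1 : S j y ≤ a := (hSZ j y).trans hy
        have h2 : ∑ i, (φ j (y i) - φ j (x i)) = S j x - S j y := by
          rw [hS, ← Finset.sum_sub_distrib]
          exact Finset.sum_congr rfl fun i _ => by ring
        simp only [h2]
        linarith
    have hsub : {x | a + τ u ≤ Z x} ⊆ ⋃ k, B k := by
      intro x hx
      obtain ⟨j, hj⟩ := hlt (lt_of_lt_of_le (by linarith : a + s < a + τ u) hx)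
      exact Set.mem_iUnion.2 ⟨j + 1, j, j.lt_succ_self, hj⟩
    have htend : Filter.Tendsto (fun k => P.real (B k)) Filter.atTop (nhds (P.real (⋃ k, B k))) :=
      (ENNReal.tendsto_toReal (measure_ne_top _ _)).comp (tendsto_measure_iUnion_atTop hBmono)
    refine le_trans (mul_le_mul_of_nonneg_left (measureReal_mono hsub) measureReal_nonneg) ?_
    exact le_of_tendsto' (htend.const_mul _) hBk
  have hcont : Filter.Tendsto (fun v => Real.exp (-v)) (nhdsWithin u (Set.Iio u))
      (nhds (Real.exp (-u))) :=
    (Real.continuous_exp.comp continuous_neg).continuousAt.tendsto.mono_left nhdsWithin_le_nhds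
  refine ge_of_tendsto hcont ?_
  filter_upwards [Ioo_mem_nhdsLT hu] with v hv using hmain v hv.1 hv.2
end

theorem theorem2 {Ω : Type*} [MeasurableSpace Ω] (μ : Measure Ω) [IsProbabilityMeasure μ]
    (n : ℕ) (F : Set (Ω → ℝ)) (hFne : F.Nonempty) (hFc : F.Countable)
    (hFm : ∀ f ∈ F, Measurable f) (hF01 : ∀ f ∈ F, ∀ ω, f ω ∈ Set.Icc (0 : ℝ) 1)
    (M : ℝ) (hM : IsMedian (Measure.pi fun _ : Fin n => μ) (empiricalSup μ F n) M)
    (L σ : ℝ) (hL : L = 1.12) (hσ : σ = Real.sqrt (uniformSecondMoment μ F n))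
    (u : ℝ) (hu : 0 ≤ u) :
    (Measure.pi fun _ : Fin n => μ).real
        {x | M + 2 * max (L * u) (σ * Real.sqrt (L * u)) ≤ empiricalSup μ F n x}
      ≤ 2 * Real.exp (-u) ∧
    (Measure.pi fun _ : Fin n => μ).real
        {x | empiricalSup μ F n x ≤ M - 2 * max (L * u) (σ * Real.sqrt (L * u))}
      ≤ 2 * Real.exp (-u) := by
  rcases hu.eq_or_lt with rfl | hu
  · have h (S : Set (Fin n → Ω)) :
        (Measure.pi fun _ : Fin n => μ).real S ≤ 2 * Real.exp (-0) := by
      have := measureReal_le_one (μ := Measure.pi fun _ : Fin n => μ) (s := S)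
      rw [neg_zero, Real.exp_zero]
      linarith
    exact ⟨h _, h _⟩
  · set τ := 2 * max (L * u) (σ * Real.sqrt (L * u)) with hτ
    obtain ⟨hM1, hM2⟩ := hM
    have h1 := measureReal_le_mul_measureReal_ge_le hFne hFc hFm hF01 hL.ge hσ hu M
    have h2 := measureReal_le_mul_measureReal_ge_le hFne hFc hFm hF01 hL.ge hσ hu (M - τ)
    rw [← hτ] at h1 h2
    rw [sub_add_cancel] at h2
    constructor
    · have := mul_le_mul_of_nonneg_right hM1 (measureReal_nonneg
        (μ := Measure.pi fun _ : Fin n => μ) (s := {x | M + τ ≤ empiricalSup μ F n x}))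
      linarith
    · have := mul_le_mul_of_nonneg_left hM2 (measureReal_nonneg
        (μ := Measure.pi fun _ : Fin n => μ) (s := {x | empiricalSup μ F n x ≤ M - τ}))
      linarith
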